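/- Let $G$ be a discrete abelian group with identity $e$, and let $A$ be a (not necessarily unital) $C^*$-algebra that is topologically $G$-graded in Exel's sense. That is, there is a linearly independent family $\{A_g : g\in G\}$ of closed linear subspaces of $A$ such that $a\in A_g$ and $b\in A_h$ imply $ab\in A_{gh}$ and $a^*\in A_{g^{-1}}$, such that $A$ is the norm closure of $\bigoplus_{g\in G}A_g$, and such that there is a bounded linear map $F:A\to A$ with $F(a)=a$ for $a\in A_e$ and $F(a)=0$ for $a\in A_g$ with $g\neq e$. Let $\widehat G$ be the compact Pontryagin dual of $G$. Then there is a strongly continuous action $\alpha:\widehat G\to\operatorname{Aut}A$ (a group homomorphism into the group of $*$-automorphisms of $A$ such that $\gamma\mapsto\alpha_\gamma(a)$ is norm-continuous for each $a\in A$) satisfying $$\alpha_\gamma(a)=\gamma(g)a\quad\text{for all }\gamma\in\widehat G,\ g\in G,\ a\in A_g,$$ and moreover $$F(a)=\int_{\widehat G}\alpha_\gamma(a)\,d\gamma\quad\text{for all }a\in A,$$ where the integral is the $A$-valued (Bochner) integral with respect to normalised Haar measure on $\widehat G$. -/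

import Mathlib

open MeasureTheory

/-- A `G`-grading of a `C⋆`-algebra `A` in Exel's sense: a linearly independent family of closed
subspaces `𝒜 g` of `A`, multiplicative and compatible with the involution, such that `A` is the
norm closure of their (algebraic) direct sum. -/
structure IsCStarGrading {G A : Type*} [Group G] [NonUnitalCStarAlgebra A]
    (𝒜 : G → Submodule ℂ A) : Prop where
  isClosed : ∀ g, IsClosed (𝒜 g : Set A)
  linearIndependent : iSupIndep 𝒜
  mul_mem : ∀ {g h : G} {a b : A}, a ∈ 𝒜 g → b ∈ 𝒜 h → a * b ∈ 𝒜 (g * h)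
  star_mem : ∀ {g : G} {a : A}, a ∈ 𝒜 g → star a ∈ 𝒜 g⁻¹
  dense : Dense ((⨆ g, 𝒜 g : Submodule ℂ A) : Set A)

/-- The bounded linear map `F : A → A` is the identity on the component of the identity of `G`
and vanishes on all the other components. -/
structure IsComponentProjection {G A : Type*} [Group G] [NonUnitalCStarAlgebra A]
    (𝒜 : G → Submodule ℂ A) (F : A →L[ℂ] A) : Prop where
  apply_of_mem_one : ∀ a ∈ 𝒜 1, F a = a
  apply_of_mem_ne : ∀ g, g ≠ 1 → ∀ a ∈ 𝒜 g, F a = 0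

/-- A topological `G`-grading of a `C⋆`-algebra in Exel's sense: a grading for which there exists
a bounded linear map that is the identity on `𝒜 1` and vanishes on `𝒜 g` for `g ≠ 1`. -/
structure IsTopologicalCStarGrading {G A : Type*} [Group G] [NonUnitalCStarAlgebra A]
    (𝒜 : G → Submodule ℂ A) : Prop extends IsCStarGrading 𝒜 where
  exists_projection : ∃ F : A →L[ℂ] A, IsComponentProjection 𝒜 F

/-! The orbit maps `γ ↦ α γ a` are built before the action. In `C(PontryaginDual G, A)` let `B` be
the closed `⋆`-algebra generated by the would-be orbits `γ ↦ γ g • a` of homogeneous `a`.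
Orthogonality of characters gives `F (f 1) = ∫ f` on `B` (`apply_eq_integral`). If `f 1 = 0`, then
`∫ star f * f = F (star (f 1) * f 1) = 0`, so `f = 0`: evaluation at `1` is injective on `B`, hence
isometric, hence onto `A` because its range is dense. Its inverse sends `a` to its orbit, and
translation invariance of `B` turns orbits into a group action. -/

/-! ### Characters and integration over the dual group. -/

/-- The characters of a discrete abelian group separate its points from the identity. -/
theorem PontryaginDual.exists_apply_ne_one {G : Type*} [CommGroup G] [TopologicalSpace G]
    [DiscreteTopology G] {g : G} (hg : g ≠ 1) : ∃ γ : PontryaginDual G, γ g ≠ 1 := by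
  obtain ⟨c, hc⟩ := CharacterModule.exists_character_apply_ne_zero_of_ne_zero
    (A := Additive G) (a := Additive.ofMul g) (by simpa using hg)
  -- The character `c` takes values in `ℚ/ℤ`; the injection into `ℝ/ℤ` makes it circle-valued.
  let ι : AddCircle (1 : ℚ) →+ AddCircle (1 : ℝ) :=
    QuotientAddGroup.map _ _ (Rat.castHom ℝ).toAddMonoidHom (by
      rw [AddSubgroup.zmultiples_le]
      simp [AddSubgroup.mem_zmultiples])
  have hι : ∀ x, ι x = 0 → x = 0 := by
    intro x
    induction x using QuotientAddGroup.induction_on with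
    | H q =>
      intro h
      obtain ⟨n, hn⟩ := (AddCircle.coe_eq_zero_iff (1 : ℝ)).1
        (show ((q : ℝ) : AddCircle (1 : ℝ)) = 0 from h)
      refine (AddCircle.coe_eq_zero_iff (1 : ℚ)).2 ⟨n, ?_⟩
      have hn' : (n : ℝ) = (q : ℝ) := by simpa using hn
      simpa using (by exact_mod_cast hn' : (n : ℚ) = q)
  let χ : G →* Circle :=
    { toFun := fun x => AddCircle.toCircle (ι (c (Additive.ofMul x)))
      map_one' := by
        rw [ofMul_one, map_zero, map_zero, AddCircle.toCircle_zero]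
      map_mul' := fun x y => by
        rw [ofMul_mul, map_add, map_add, AddCircle.toCircle_add] }
  refine ⟨(⟨χ, continuous_of_discreteTopology⟩ : G →ₜ* Circle), fun h => hc (hι _ ?_)⟩
  apply AddCircle.injective_toCircle (one_ne_zero (α := ℝ))
  rw [AddCircle.toCircle_zero]
  exact h

theorem PontryaginDual.mul_apply {G : Type*} [CommGroup G] [TopologicalSpace G]
    (γ δ : PontryaginDual G) (g : G) : (γ * δ) g = γ g * δ g := rfl

theorem PontryaginDual.continuous_eval_const {G : Type*} [CommGroup G] [TopologicalSpace G]
    (g : G) : Continuous fun γ : PontryaginDual G => γ g :=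
  ContinuousEvalConst.continuous_eval_const (F := G →ₜ* Circle) g

/-- A nontrivial element of a discrete abelian group, seen as a character of the dual group, has
integral zero. -/
theorem PontryaginDual.integral_apply_eq_zero {G : Type*} [CommGroup G] [TopologicalSpace G]
    [DiscreteTopology G] [MeasurableSpace (PontryaginDual G)] [BorelSpace (PontryaginDual G)]
    (μ : Measure (PontryaginDual G)) [μ.IsHaarMeasure] {g : G} (hg : g ≠ 1) :
    ∫ γ : PontryaginDual G, (γ g : ℂ) ∂μ = 0 := by
  obtain ⟨δ, hδ⟩ := exists_apply_ne_one hg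
  -- Translating by `δ` multiplies the integral by `δ g ≠ 1` yet leaves it unchanged.
  have h := integral_mul_left_eq_self (μ := μ) (fun γ : PontryaginDual G => (γ g : ℂ)) δ
  simp only [mul_apply, Circle.coe_mul, integral_const_mul] at h
  have h' : ((δ g : ℂ) - 1) * ∫ γ : PontryaginDual G, (γ g : ℂ) ∂μ = 0 := by
    rw [sub_mul, h, one_mul, sub_self]
  refine (mul_eq_zero.1 h').resolve_left fun h0 => hδ ?_
  exact Circle.ext (by simpa using sub_eq_zero.1 h0)

theorem Continuous.integrable_of_compactSpace {X E : Type*} [TopologicalSpace X] [CompactSpace X]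
    [MeasurableSpace X] [BorelSpace X] [NormedAddCommGroup E] (μ : Measure X)
    [IsFiniteMeasureOnCompacts μ] {f : X → E} (hf : Continuous f) : Integrable f μ :=
  hf.integrable_of_hasCompactSupport (HasCompactSupport.of_compactSpace f)

/-- A continuous `C⋆`-algebra-valued function `f` on a compact space vanishes if the integral of
`star f * f` against a finite measure of full support is zero. -/
theorem ContinuousMap.eq_zero_of_integral_star_mul_self {X A : Type*} [TopologicalSpace X]
    [CompactSpace X] [MeasurableSpace X] [BorelSpace X] [NonUnitalCStarAlgebra A] (μ : Measure X)
    [IsFiniteMeasure μ] [μ.IsOpenPosMeasure] (f : C(X, A))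
    (hf : ∫ x, star (f x) * f x ∂μ = 0) : f = 0 := by
  let _ := CStarAlgebra.spectralOrder A
  have _ := CStarAlgebra.spectralOrderedRing A
  have hcont : Continuous fun x => star (f x) * f x := by fun_prop
  have hint : Integrable (fun x => star (f x) * f x) μ := hcont.integrable_of_compactSpace μ
  have hpos : ∀ x, 0 ≤ star (f x) * f x := fun x => star_mul_self_nonneg (f x)
  -- The integrals over `s` and its complement are positive elements with sum zero, so both vanish.
  have hae : (fun x => star (f x) * f x) =ᵐ[μ] 0 := by
    refine hint.ae_eq_zero_of_forall_setIntegral_eq_zero fun s hs _ => ?_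
    have h := integral_add_compl hs hint
    rw [hf] at h
    exact (add_eq_zero_iff_of_nonneg (integral_nonneg hpos) (integral_nonneg hpos)).1 h |>.1
  have hz := Continuous.ae_eq_iff_eq μ hcont continuous_zero |>.1 hae
  ext x
  exact CStarRing.star_mul_self_eq_zero_iff _ |>.1 (congrFun hz x)

/-! ### The algebra of orbit functions on the dual group. -/

namespace IsCStarGrading

variable {G A : Type*} [CommGroup G] [TopologicalSpace G]
  [NonUnitalCStarAlgebra A] {𝒜 : G → Submodule ℂ A}

/-- The `A`-valued function `γ ↦ γ g • a` on the dual group. -/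
noncomputable def homogeneousMap (g : G) (a : A) : C(PontryaginDual G, A) where
  toFun γ := (γ g : ℂ) • a
  continuous_toFun := by
    exact (continuous_subtype_val.comp (PontryaginDual.continuous_eval_const g)).smul
      continuous_const

@[simp]
theorem homogeneousMap_apply (g : G) (a : A) (γ : PontryaginDual G) :
    homogeneousMap g a γ = (γ g : ℂ) • a := rfl

theorem homogeneousMap_mul (g h : G) (a b : A) :
    homogeneousMap g a * homogeneousMap h b = homogeneousMap (g * h) (a * b) := by
  ext γ
  simp [smul_mul_smul_comm]

theorem star_homogeneousMap (g : G) (a : A) :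
    star (homogeneousMap g a) = homogeneousMap g⁻¹ (star a) := by
  ext γ
  simp [star_smul, ← Circle.coe_inv_eq_conj]

/-- The linear span of the functions `γ ↦ γ g • a` with `a` homogeneous of degree `g`. -/
noncomputable def homogeneousSpan (𝒜 : G → Submodule ℂ A) : Submodule ℂ C(PontryaginDual G, A) :=
  Submodule.span ℂ {f | ∃ g, ∃ a ∈ 𝒜 g, homogeneousMap g a = f}

theorem homogeneousMap_mem_span {g : G} {a : A} (ha : a ∈ 𝒜 g) :
    homogeneousMap g a ∈ homogeneousSpan 𝒜 :=
  Submodule.subset_span ⟨g, a, ha, rfl⟩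

variable [DiscreteTopology G]

/-- The `⋆`-algebra of functions spanned by the functions `γ ↦ γ g • a` with `a` homogeneous of
degree `g`. -/
noncomputable def homogeneousSubalgebra (h𝒜 : IsCStarGrading 𝒜) :
    NonUnitalStarSubalgebra ℂ C(PontryaginDual G, A) where
  __ := homogeneousSpan 𝒜
  mul_mem' := by
    intro f f' hf hf'
    change f ∈ homogeneousSpan 𝒜 at hf
    change f' ∈ homogeneousSpan 𝒜 at hf'
    change f * f' ∈ homogeneousSpan 𝒜
    induction hf, hf' using Submodule.span_induction₂ with
    | mem_mem x y hx hy =>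
      obtain ⟨g, a, ha, rfl⟩ := hx
      obtain ⟨h, b, hb, rfl⟩ := hy
      rw [homogeneousMap_mul]
      exact homogeneousMap_mem_span (h𝒜.mul_mem ha hb)
    | zero_left y hy => simp
    | zero_right x hx => simp
    | add_left x y z hx hy hz h1 h2 => rw [add_mul]; exact add_mem h1 h2
    | add_right x y z hx hy hz h1 h2 => rw [mul_add]; exact add_mem h1 h2
    | smul_left r x y hx hy h => rw [smul_mul_assoc]; exact Submodule.smul_mem _ r h
    | smul_right r x y hx hy h => rw [mul_smul_comm]; exact Submodule.smul_mem _ r h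
  star_mem' := by
    intro f hf
    change f ∈ homogeneousSpan 𝒜 at hf
    change star f ∈ homogeneousSpan 𝒜
    induction hf using Submodule.span_induction with
    | mem x hx =>
      obtain ⟨g, a, ha, rfl⟩ := hx
      rw [star_homogeneousMap]
      exact homogeneousMap_mem_span (h𝒜.star_mem ha)
    | zero => simp
    | add x y hx hy h1 h2 => rw [star_add]; exact add_mem h1 h2
    | smul r x hx h => rw [star_smul]; exact Submodule.smul_mem _ _ h

/-- The `C⋆`-algebra of functions on the dual group generated by the functions `γ ↦ γ g • a` with
`a` homogeneous of degree `g`. -/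
noncomputable def orbitAlgebra (h𝒜 : IsCStarGrading 𝒜) : NonUnitalStarSubalgebra ℂ C(PontryaginDual G, A) :=
  h𝒜.homogeneousSubalgebra.topologicalClosure

/-- Closedness makes the orbit algebra a `C⋆`-algebra, so that injective `⋆`-homomorphisms out of it
are isometric. -/
instance isClosed_orbitAlgebra (h𝒜 : IsCStarGrading 𝒜) :
    IsClosed (h𝒜.orbitAlgebra : Set C(PontryaginDual G, A)) :=
  NonUnitalStarSubalgebra.isClosed_topologicalClosure _

theorem homogeneousMap_mem_orbitAlgebra (h𝒜 : IsCStarGrading 𝒜) {g : G} {a : A}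
    (ha : a ∈ 𝒜 g) : homogeneousMap g a ∈ h𝒜.orbitAlgebra :=
  subset_closure (homogeneousMap_mem_span ha)

/-- The orbit algebra is invariant under translations of the dual group. -/
theorem comp_mulRight_mem_orbitAlgebra (h𝒜 : IsCStarGrading 𝒜) (δ : PontryaginDual G)
    {f : C(PontryaginDual G, A)} (hf : f ∈ h𝒜.orbitAlgebra) :
    f.comp (ContinuousMap.mulRight δ) ∈ h𝒜.orbitAlgebra := by
  refine map_mem_closure (s := (homogeneousSpan 𝒜 : Set C(PontryaginDual G, A)))
    (f := fun f : C(PontryaginDual G, A) => f.comp (ContinuousMap.mulRight δ))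
    (ContinuousMap.continuous_precomp (ContinuousMap.mulRight δ)) hf ?_
  intro f hf
  change f ∈ homogeneousSpan 𝒜 at hf
  change f.comp (ContinuousMap.mulRight δ) ∈ homogeneousSpan 𝒜
  induction hf using Submodule.span_induction with
  | mem x hx =>
    obtain ⟨g, a, ha, rfl⟩ := hx
    -- Translation by `δ` replaces `a` by `δ g • a`, of the same degree.
    convert! homogeneousMap_mem_span (Submodule.smul_mem _ (δ g : ℂ) ha) using 1
    ext γ
    simp [PontryaginDual.mul_apply, mul_smul]
  | zero => exact zero_mem _
  | add x y hx hy h1 h2 => exact add_mem h1 h2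
  | smul r x hx h => exact Submodule.smul_mem _ r h

/-- Evaluation at the identity of the dual group, as a `⋆`-homomorphism on the orbit algebra. -/
noncomputable def evalOne (h𝒜 : IsCStarGrading 𝒜) : h𝒜.orbitAlgebra →⋆ₙₐ[ℂ] A where
  toFun f := (f : C(PontryaginDual G, A)) 1
  map_smul' _ _ := rfl
  map_zero' := rfl
  map_add' _ _ := rfl
  map_mul' _ _ := rfl
  map_star' _ := rfl

theorem evalOne_apply (h𝒜 : IsCStarGrading 𝒜) (f : h𝒜.orbitAlgebra) :
    h𝒜.evalOne f = (f : C(PontryaginDual G, A)) 1 := rfl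

variable [MeasurableSpace (PontryaginDual G)] [BorelSpace (PontryaginDual G)]

/-- The component projection of the value at the identity of a function in the orbit algebra is
the mean value of the function. -/
theorem apply_eq_integral (h𝒜 : IsCStarGrading 𝒜) {F : A →L[ℂ] A}
    (hF : IsComponentProjection 𝒜 F) (μ : Measure (PontryaginDual G)) [μ.IsHaarMeasure]
    [IsProbabilityMeasure μ] {f : C(PontryaginDual G, A)} (hf : f ∈ h𝒜.orbitAlgebra) :
    F (f 1) = ∫ γ, f γ ∂μ := by
  have hint (f : C(PontryaginDual G, A)) : Integrable f μ :=
    f.continuous.integrable_of_compactSpace μ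
  have hcont : Continuous fun f : C(PontryaginDual G, A) => ∫ γ, f γ ∂μ := by
    refine (LipschitzWith.of_dist_le_mul (K := 1) fun f f' => ?_).continuous
    rw [dist_eq_norm, ← integral_sub (hint f) (hint f'), NNReal.coe_one, one_mul]
    simpa using norm_integral_le_of_norm_le_const (μ := μ) (C := dist f f') <|
      .of_forall fun γ => by
        rw [← dist_eq_norm]
        exact ContinuousMap.dist_apply_le_dist γ
  -- Both sides are continuous in `f`, so the spanning functions suffice.
  refine closure_minimal (s := (homogeneousSpan 𝒜 : Set C(PontryaginDual G, A)))
    (t := {f : C(PontryaginDual G, A) | F (f 1) = ∫ γ, f γ ∂μ}) ?_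
    (isClosed_eq (F.continuous.comp (continuous_eval_const 1)) hcont) hf
  intro f hf
  induction hf using Submodule.span_induction with
  | mem x hx =>
    obtain ⟨g, a, ha, rfl⟩ := hx
    rcases eq_or_ne g 1 with rfl | hg
    · simp [hF.apply_of_mem_one a ha]
    · simp [hF.apply_of_mem_ne g hg a ha, integral_smul_const,
        PontryaginDual.integral_apply_eq_zero μ hg]
  | zero => simp
  | add x y hx hy h1 h2 =>
    simp only [Set.mem_ofPred_eq] at h1 h2
    simp [h1, h2, integral_add (hint x) (hint y)]
  | smul r x hx h =>
    simp only [Set.mem_ofPred_eq] at h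
    simp [h, integral_smul]

end IsCStarGrading

/-! ### Inverting evaluation at the identity, and the dual action. -/

namespace IsTopologicalCStarGrading

open IsCStarGrading

variable {G A : Type*} [CommGroup G] [TopologicalSpace G] [DiscreteTopology G]
  [NonUnitalCStarAlgebra A] {𝒜 : G → Submodule ℂ A}

/-- A function in the orbit algebra of a topological grading is determined by its value at the
identity. -/
theorem eq_zero_of_apply_one_eq_zero (h𝒜 : IsTopologicalCStarGrading 𝒜)
    {f : C(PontryaginDual G, A)} (hf : f ∈ h𝒜.orbitAlgebra) (h1 : f 1 = 0) : f = 0 := by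
  borelize (PontryaginDual G)
  obtain ⟨F, hF⟩ := h𝒜.exists_projection
  let μ : Measure (PontryaginDual G) := Measure.haarMeasure ⊤
  have : IsProbabilityMeasure μ := ⟨Measure.haarMeasure_self⟩
  refine f.eq_zero_of_integral_star_mul_self μ ?_
  have h := h𝒜.apply_eq_integral hF μ (mul_mem (star_mem hf) hf)
  simpa [h1] using h.symm

theorem evalOne_bijective (h𝒜 : IsTopologicalCStarGrading 𝒜) :
    Function.Bijective h𝒜.evalOne := by
  have hinj : Function.Injective h𝒜.evalOne :=
    (injective_iff_map_eq_zero _).2 fun f hf =>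
      Subtype.ext (eq_zero_of_apply_one_eq_zero h𝒜 f.2 hf)
  refine ⟨hinj, ?_⟩
  have hclosed : IsClosed (Set.range h𝒜.evalOne) :=
    (NonUnitalStarAlgHom.isometry h𝒜.evalOne hinj).isClosedEmbedding.isClosed_range
  have hle : (⨆ g, 𝒜 g) ≤ LinearMap.range (h𝒜.evalOne : h𝒜.orbitAlgebra →ₗ[ℂ] A) :=
    iSup_le fun g a ha =>
      ⟨⟨homogeneousMap g a, h𝒜.homogeneousMap_mem_orbitAlgebra ha⟩, by simp [evalOne_apply]⟩
  have hdense : Dense (Set.range h𝒜.evalOne) := h𝒜.dense.mono hle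
  rw [← Set.range_eq_univ, ← hclosed.closure_eq, hdense.closure_eq]

/-- The orbit map: the `⋆`-isomorphism that extends an element `a` of a topologically graded
`C⋆`-algebra to the function in the orbit algebra whose value at the identity is `a`. -/
noncomputable def orbitEquiv (h𝒜 : IsTopologicalCStarGrading 𝒜) : A ≃⋆ₐ[ℂ] h𝒜.orbitAlgebra :=
  (StarAlgEquiv.ofBijective h𝒜.evalOne (evalOne_bijective h𝒜)).symm

/-- The orbit `γ ↦ α_γ a` of an element under the dual action. -/
noncomputable def orbit (h𝒜 : IsTopologicalCStarGrading 𝒜) (a : A) : C(PontryaginDual G, A) :=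
  orbitEquiv h𝒜 a

theorem orbit_mem (h𝒜 : IsTopologicalCStarGrading 𝒜) (a : A) : orbit h𝒜 a ∈ h𝒜.orbitAlgebra :=
  (orbitEquiv h𝒜 a).2

theorem orbit_apply_one (h𝒜 : IsTopologicalCStarGrading 𝒜) (a : A) : orbit h𝒜 a 1 = a :=
  (orbitEquiv h𝒜).symm_apply_apply a

theorem orbit_eq_of_mem (h𝒜 : IsTopologicalCStarGrading 𝒜) {f : C(PontryaginDual G, A)}
    (hf : f ∈ h𝒜.orbitAlgebra) : orbit h𝒜 (f 1) = f :=
  congrArg Subtype.val ((orbitEquiv h𝒜).apply_symm_apply ⟨f, hf⟩)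

theorem orbit_of_mem (h𝒜 : IsTopologicalCStarGrading 𝒜) {g : G} {a : A} (ha : a ∈ 𝒜 g) :
    orbit h𝒜 a = homogeneousMap g a := by
  simpa using orbit_eq_of_mem h𝒜 (h𝒜.homogeneousMap_mem_orbitAlgebra ha)

/-- The translate of the orbit of `a` by `δ` lies in the orbit algebra and has value `orbit h𝒜 a δ`
at `1`, so it is the orbit of that element. -/
theorem orbit_orbit_apply (h𝒜 : IsTopologicalCStarGrading 𝒜) (γ δ : PontryaginDual G) (a : A) :
    orbit h𝒜 (orbit h𝒜 a δ) γ = orbit h𝒜 a (γ * δ) := by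
  have h := orbit_eq_of_mem h𝒜 (h𝒜.comp_mulRight_mem_orbitAlgebra δ (orbit_mem h𝒜 a))
  simpa using DFunLike.congr_fun h γ

/-- The action of the dual group on a topologically graded `C⋆`-algebra. -/
noncomputable def dualAction (h𝒜 : IsTopologicalCStarGrading 𝒜) :
    PontryaginDual G →* (A ≃⋆ₐ[ℂ] A) where
  toFun γ :=
    { toFun := fun a => orbit h𝒜 a γ
      invFun := fun a => orbit h𝒜 a γ⁻¹
      left_inv := fun a => by
        simp only [orbit_orbit_apply, inv_mul_cancel, orbit_apply_one]
      right_inv := fun a => by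
        simp only [orbit_orbit_apply, mul_inv_cancel, orbit_apply_one]
      map_mul' := fun a b => by simp [orbit]
      map_add' := fun a b => by simp [orbit]
      map_star' := fun a => by simp [orbit, map_star]
      map_smul' := fun c a => by simp [orbit] }
  map_one' := StarAlgEquiv.ext fun a => orbit_apply_one h𝒜 a
  map_mul' γ δ := StarAlgEquiv.ext fun a => (orbit_orbit_apply h𝒜 γ δ a).symm

theorem dualAction_apply (h𝒜 : IsTopologicalCStarGrading 𝒜) (γ : PontryaginDual G) (a : A) :
    dualAction h𝒜 γ a = orbit h𝒜 a γ := rfl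

end IsTopologicalCStarGrading

theorem theorem1 {G A : Type*} [CommGroup G] [TopologicalSpace G] [DiscreteTopology G]
    [NonUnitalCStarAlgebra A] [MeasurableSpace (PontryaginDual G)] [BorelSpace (PontryaginDual G)]
    (𝒜 : G → Submodule ℂ A) (h𝒜 : IsTopologicalCStarGrading 𝒜) :
    ∃ α : PontryaginDual G →* (A ≃⋆ₐ[ℂ] A),
      (∀ a : A, Continuous fun γ => α γ a) ∧
      (∀ (γ : PontryaginDual G) (g : G), ∀ a ∈ 𝒜 g, α γ a = (γ g : ℂ) • a) ∧
      ∀ F : A →L[ℂ] A, IsComponentProjection 𝒜 F →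
        ∀ μ : Measure (PontryaginDual G), μ.IsHaarMeasure → IsProbabilityMeasure μ →
          ∀ a : A, Integrable (fun γ => α γ a) μ ∧ F a = ∫ γ, α γ a ∂μ := by
  refine ⟨h𝒜.dualAction, fun a => (h𝒜.orbit a).continuous, fun γ g a ha => ?_,
    fun F hF μ _ _ a => ⟨(h𝒜.orbit a).continuous.integrable_of_compactSpace μ, ?_⟩⟩
  · rw [h𝒜.dualAction_apply, h𝒜.orbit_of_mem ha, IsCStarGrading.homogeneousMap_apply]
  · simpa [h𝒜.dualAction_apply, h𝒜.orbit_apply_one] using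
      h𝒜.apply_eq_integral hF μ (h𝒜.orbit_mem a)
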